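/- Let $1<\alpha<2$, let $S_m$ be the Euclidean unit sphere of $\mathbb R^m$, and write $x^{\langle a\rangle}=|x|^a\,\mathrm{sign}(x)$. A random vector $V$ in $\mathbb R^m$ is symmetric $\alpha$-stable (S$\alpha$S) with spectral measure $\Gamma$ if $\Gamma$ is a finite symmetric measure on $S_m$ and $E e^{i\langle\theta,V\rangle}=\exp\{-\int_{S_m}|\langle\theta,s\rangle|^{\alpha}\,\Gamma(ds)\}$ for all $\theta\in\mathbb R^m$. For an S$\alpha$S vector $(U,Y)$ in $\mathbb R^2$ with spectral measure $\Gamma_{U,Y}$, the covariation of $U$ on $Y$ is $$CV(U,Y)=\int_{S_2}s_1 s_2^{\langle\alpha-1\rangle}\,\Gamma_{U,Y}(ds)=\frac{E[U\,Y^{\langle q-1\rangle}]\,\sigma_Y^{\alpha}}{E|Y|^q}\quad(1\le q<\alpha),\qquad \sigma_Y=\Big(\int_{S_2}|s_2|^\alpha\,\Gamma_{U,Y}(ds)\Big)^{1/\alpha},$$ the quotient being read as $0$ if $Y=0$ almost surely. Let $\Theta(t)$, $t\in\mathbb Z$, be real $m\times m$ matrices, periodic in $t$ with period $T\in\{1,2,\dots\}$,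 and let $\mathbf Z(t)$, $t\in\mathbb Z$, be independent random vectors in $\mathbb R^m$, each of them S$\alpha$S with the same spectral measure $\Gamma$. Put $g(t,t+1)=I$ and $g(t,u)=\Theta(t)\Theta(t-1)\cdots\Theta(u)$ for $u\le t$, and assume that $\sum_{j=0}^{\infty}|g_{rl}(t,t-j+1)|<\infty$ for all $t\in\mathbb Z$ and $r,l\in\{1,\dots,m\}$. Let $$\mathbf X(t)=(X_1(t),\dots,X_m(t))=\sum_{j=0}^{\infty}g(t,t-j+1)\,\mathbf Z(t-j),\qquad t\in\mathbb Z$$ (a series that converges absolutely almost surely), be the bounded solution of the PAR(1) equation $\mathbf X(t)=\Theta(t)\mathbf X(t-1)+\mathbf Z(t)$. Then for all $s,t\in\mathbb Z$ and all $r\ne l$ in $\{1,\dots,m\}$ the vector $(X_r(s),X_l(t))$ is S$\alpha$S, and its cross-covariation is given by the following convergent series. (a) If $s\ge t$, then $$CV(X_r(s),X_l(t))=\sum_{j=0}^{\infty}\int_{S_m}\Big(\sum_{k=1}^m g_{lk}(t,t-j+1)s_k\Big)^{\langle\alpha-1\rangle}\Big(\sum_{k=1}^m g_{rk}(s,t-j+1)s_k\Big)\Gamma(ds).$$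 (b) If $s\le t$, then $$CV(X_r(s),X_l(t))=\sum_{j=0}^{\infty}\int_{S_m}\Big(\sum_{k=1}^m g_{lk}(t,s-j+1)s_k\Big)^{\langle\alpha-1\rangle}\Big(\sum_{k=1}^m g_{rk}(s,s-j+1)s_k\Big)\Gamma(ds).$$ -/

import Mathlib

open MeasureTheory ProbabilityTheory
open scoped Matrix

noncomputable section

namespace StablePAR

/-- The signed power `x^⟨a⟩ = |x|^a sign(x)`. -/
def signedPow (x a : ℝ) : ℝ := |x| ^ a * Real.sign x

/-- The unit sphere `S_m` of `ℝ^m` with the Euclidean norm. -/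
abbrev UnitSphere (m : ℕ) : Type := Metric.sphere (0 : EuclideanSpace ℝ (Fin m)) 1

/-- The random vector `X` with values in `ℝ^m` is symmetric `α`-stable with spectral measure `Γ`:
`Γ` is a finite symmetric measure on the unit sphere, and the characteristic function of `X` is
`θ ↦ exp (-∫ |⟨θ, s⟩|^α Γ(ds))`. -/
structure IsSymStable {Ω : Type*} [MeasurableSpace Ω] {m : ℕ} (α : ℝ) (P : Measure Ω)
    (X : Ω → EuclideanSpace ℝ (Fin m)) (Γ : Measure (UnitSphere m)) : Prop where
  aemeasurable : AEMeasurable X P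
  finite : IsFiniteMeasure Γ
  symmetric : Γ.map (fun s => -s) = Γ
  charFun_eq : ∀ θ : EuclideanSpace ℝ (Fin m),
    charFun (P.map X) θ =
      Complex.exp (-((∫ s, |inner ℝ θ (s : EuclideanSpace ℝ (Fin m))| ^ α ∂Γ : ℝ) : ℂ))

/-- The random vector `(X, Y)` in `ℝ^2`. -/
def pair {Ω : Type*} (X Y : Ω → ℝ) : Ω → EuclideanSpace ℝ (Fin 2) := fun ω => !₂[X ω, Y ω]

/-- `∫ s₁ s₂^⟨α-1⟩ Γ(ds)` for a measure `Γ` on the unit circle. -/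
def spectralCovariation (α : ℝ) (Γ : Measure (UnitSphere 2)) : ℝ :=
  ∫ s, s.1 0 * signedPow (s.1 1) (α - 1) ∂Γ

/-- The scale parameter `(∫ |s₂|^α Γ(ds))^(1/α)` of the second component of a symmetric
`α`-stable vector with spectral measure `Γ`. -/
def scaleSnd (α : ℝ) (Γ : Measure (UnitSphere 2)) : ℝ :=
  (∫ s, |s.1 1| ^ α ∂Γ) ^ (1 / α)

/-- The expression `E[X Y^⟨q-1⟩] σ_Y^α / E|Y|^q`, with `Γ` the spectral measure of `(X, Y)`.
For `Y = 0` a.s. it is `0`. -/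
def momentCovariation {Ω : Type*} [MeasurableSpace Ω] (α q : ℝ) (P : Measure Ω) (X Y : Ω → ℝ)
    (Γ : Measure (UnitSphere 2)) : ℝ :=
  (∫ ω, X ω * signedPow (Y ω) (q - 1) ∂P) * scaleSnd α Γ ^ α / ∫ ω, |Y ω| ^ q ∂P

/-- The covariation `CV(X, Y)` exists and equals `c`: the vector `(X, Y)` is symmetric `α`-stable,
and `c` is the value given by its spectral measure as well as by the moments of every order
`q ∈ [1, α)`, which exist. -/
structure HasCovariation {Ω : Type*} [MeasurableSpace Ω] (α : ℝ) (P : Measure Ω) (X Y : Ω → ℝ)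
    (c : ℝ) : Prop where
  exists_spectral : ∃ Γ : Measure (UnitSphere 2), IsSymStable α P (pair X Y) Γ
  spectral_eq : ∀ Γ : Measure (UnitSphere 2), IsSymStable α P (pair X Y) Γ →
    spectralCovariation α Γ = c
  integrable_mul : ∀ q : ℝ, 1 ≤ q → q < α →
    Integrable (fun ω => X ω * signedPow (Y ω) (q - 1)) P
  integrable_pow : ∀ q : ℝ, 1 ≤ q → q < α → Integrable (fun ω => |Y ω| ^ q) P
  moment_eq : ∀ Γ : Measure (UnitSphere 2), IsSymStable α P (pair X Y) Γ →
    ∀ q : ℝ, 1 ≤ q → q < α → momentCovariation α q P X Y Γ = c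

/-- `g Θ t u = Θ(t) Θ(t-1) ⋯ Θ(u)` for `u ≤ t`, and `g Θ t (t+1) = I`. -/
def g {m : ℕ} (Θ : ℤ → Matrix (Fin m) (Fin m) ℝ) (t u : ℤ) : Matrix (Fin m) (Fin m) ℝ :=
  ((List.range (t + 1 - u).toNat).map fun k : ℕ => Θ (t - k)).prod

/-- The `m`-dimensional symmetric `α`-stable PAR(1) equation `X(t) = Θ(t) X(t-1) + Z(t)` with
period `T ≥ 1`: the coefficients are `T`-periodic, the noise vectors `Z(t)` are independent
and each of them is symmetric `α`-stable with spectral measure `Γ`. -/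
structure IsStablePAR1 {Ω : Type*} [MeasurableSpace Ω] {m : ℕ} (α : ℝ) (T : ℕ) (P : Measure Ω)
    (Γ : Measure (UnitSphere m)) (Θ : ℤ → Matrix (Fin m) (Fin m) ℝ)
    (Z X : ℤ → Ω → EuclideanSpace ℝ (Fin m)) : Prop where
  period_pos : 0 < T
  periodic : ∀ t : ℤ, Θ (t + T) = Θ t
  noise_measurable : ∀ t, Measurable (Z t)
  noise_indep : iIndepFun Z P
  noise_stable : ∀ t, IsSymStable α P (Z t) Γ
  equation : ∀ t : ℤ, ∀ᵐ ω ∂P, ∀ i : Fin m,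
    X t ω i = (Θ t *ᵥ (X (t - 1) ω).ofLp) i + Z t ω i

/-- `X(t) = ∑_{j ≥ 0} g(t, t-j+1) Z(t-j)`, with almost surely absolutely convergent components,
under the absolute summability of the entries of `g(t, t-j+1)`. -/
structure IsBoundedSolution {Ω : Type*} [MeasurableSpace Ω] {m : ℕ} (P : Measure Ω)
    (Θ : ℤ → Matrix (Fin m) (Fin m) ℝ) (Z X : ℤ → Ω → EuclideanSpace ℝ (Fin m)) : Prop where
  summable_coeff : ∀ (t : ℤ) (r l : Fin m), Summable fun j : ℕ => |g Θ t (t - j + 1) r l|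
  hasSum : ∀ t : ℤ, ∀ᵐ ω ∂P, ∀ i : Fin m,
    HasSum (fun j : ℕ => (g Θ t (t - j + 1) *ᵥ (Z (t - j) ω).ofLp) i) (X t ω i)

/-- `∫ (∑_k g_{lk}(t, u) s_k)^⟨α-1⟩ (∑_k g_{rk}(s, u) s_k) Γ(ds)`. -/
def covTerm {m : ℕ} (α : ℝ) (Γ : Measure (UnitSphere m)) (Θ : ℤ → Matrix (Fin m) (Fin m) ℝ)
    (r l : Fin m) (s t u : ℤ) : ℝ :=
  ∫ x : UnitSphere m, signedPow (∑ k, g Θ t u l k * x.1 k) (α - 1) * ∑ k, g Θ s u r k * x.1 k ∂Γ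

end StablePAR

end

open scoped Topology

namespace StablePAR

/-! Index the noise by its own time `u`, not by the lag. Then `X_r(s) = ∑_u ⟨A_u, Z_u⟩` and `X_l(t)
= ∑_u ⟨B_u, Z_u⟩` are series in the same independent vectors, with absolutely summable coefficient
rows that vanish for `u > s` and `u > t` respectively. Let `μ` be the measure on `ℤ × S_m` that puts
a copy of `Γ` on each slice, and let `a(u,x) = ⟨A_u, x⟩`, `b(u,x) = ⟨B_u, x⟩`. Independence gives
the joint characteristic function `exp(-∫ |θ₀ a + θ₁ b|^α dμ)` (`charFun_of_hasSum_inner`).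

Everything else follows from this exponent (`hasCovariation_of_charFun`). Its polar form is a
spectral measure. For any spectral measure, differentiating `θ ↦ ∫ |θ a + b|^α dμ` at `0` identifies
the covariation as `∫ a b^⟨α-1⟩ dμ`. Differentiating `E|θX + Y|^q`, which is a power of the same
function times `E|Y|^q`, gives the moment formula for `q > 1`; `q = 1` is a limit. Finally `∫ a
b^⟨α-1⟩ dμ` is a sum over `u`, in which only `u ≤ min(s,t)` contributes. -/

theorem measurable_signedPow (a : ℝ) : Measurable fun x : ℝ => signedPow x a := by
  have : Measurable Real.sign :=
    Measurable.ite measurableSet_Iio measurable_const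
      (Measurable.ite measurableSet_Ioi measurable_const measurable_const)
  unfold signedPow
  fun_prop

theorem abs_signedPow_le (x a : ℝ) : |signedPow x a| ≤ |x| ^ a := by
  rw [signedPow, abs_mul, abs_of_nonneg (Real.rpow_nonneg (abs_nonneg x) a)]
  refine mul_le_of_le_one_right (Real.rpow_nonneg (abs_nonneg x) a) ?_
  rcases Real.sign_apply_eq x with h | h | h <;> simp [h]

theorem signedPow_zero (a : ℝ) : signedPow 0 a = 0 := by simp [signedPow]

theorem hasDerivAt_abs_mul_add_rpow {p : ℝ} (hp : 1 < p) (a b θ : ℝ) :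
    HasDerivAt (fun θ => |θ * a + b| ^ p) (p * (a * signedPow (θ * a + b) (p - 1))) θ := by
  have h1 : HasDerivAt (fun θ : ℝ => θ * a + b) a θ := by
    simpa using ((hasDerivAt_id θ).mul_const a).add_const b
  have h2 := (hasDerivAt_abs_rpow (θ * a + b) hp).comp θ h1
  convert! h2 using 1
  have : signedPow (θ * a + b) (p - 1) = |θ * a + b| ^ (p - 2) * (θ * a + b) := by
    rcases eq_or_ne (θ * a + b) 0 with h | h
    · rw [h, signedPow_zero, mul_zero]
    · have h' : p - 1 = (p - 2) + 1 := by ring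
      rw [signedPow, h', Real.rpow_add_one (abs_ne_zero.2 h), mul_assoc]
      congr 1
      rcases lt_or_gt_of_ne h with h | h
      · rw [abs_of_neg h, Real.sign_of_neg h]; ring
      · rw [abs_of_pos h, Real.sign_of_pos h]; ring
  rw [this]; ring

/-! ### Differentiation of `L^p` integrals along a line. -/

section Integral

variable {S : Type*} [MeasurableSpace S] {μ : Measure S} {p : ℝ} {a b : S → ℝ}

theorem integrable_abs_rpow_of_memLp (hp : 0 < p) (ha : MemLp a (ENNReal.ofReal p) μ) :
    Integrable (fun x => |a x| ^ p) μ := by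
  have := ha.integrable_norm_rpow (by simpa using hp) (by simp)
  simpa [ENNReal.toReal_ofReal hp.le] using this

theorem integrable_abs_add_abs_rpow (hp : 0 < p) (ha : MemLp a (ENNReal.ofReal p) μ)
    (hb : MemLp b (ENNReal.ofReal p) μ) : Integrable (fun x => (|a x| + |b x|) ^ p) μ := by
  have := integrable_abs_rpow_of_memLp hp (ha.norm.add hb.norm)
  refine this.congr (.of_forall fun x => ?_)
  simp only [Pi.add_apply, Real.norm_eq_abs]
  rw [abs_of_nonneg (by positivity)]

/-- For `z = θx + y` with `|θ| ≤ 1` the bound is free of `θ`, so it serves both for integrability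
and as the majorant when differentiating under the integral. -/
theorem abs_mul_signedPow_le (hp : 1 ≤ p) {x y z : ℝ} (hz : |z| ≤ |x| + |y|) :
    |x * signedPow z (p - 1)| ≤ (|x| + |y|) ^ p := by
  rw [abs_mul]
  have h0 : 0 ≤ |x| + |y| := by positivity
  calc |x| * |signedPow z (p - 1)| ≤ (|x| + |y|) * (|x| + |y|) ^ (p - 1) := by
        gcongr
        · linarith [abs_nonneg y]
        · exact (abs_signedPow_le z _).trans
            (Real.rpow_le_rpow (abs_nonneg z) hz (by linarith))
    _ = (|x| + |y|) ^ p := by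
        rw [mul_comm, ← Real.rpow_add_one' h0 (by linarith)]; congr 1; ring

theorem integrable_mul_signedPow (hp : 1 ≤ p) (ha : MemLp a (ENNReal.ofReal p) μ)
    (hb : MemLp b (ENNReal.ofReal p) μ) :
    Integrable (fun x => a x * signedPow (b x) (p - 1)) μ := by
  refine (integrable_abs_add_abs_rpow (by linarith) ha hb).mono'
    (ha.1.mul ((measurable_signedPow _).comp_aemeasurable hb.1.aemeasurable).aestronglyMeasurable)
    (.of_forall fun x => ?_)
  exact abs_mul_signedPow_le hp (by linarith [abs_nonneg (a x)])

theorem hasDerivAt_integral_abs_mul_add_rpow (hp : 1 < p) (ha : MemLp a (ENNReal.ofReal p) μ)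
    (hb : MemLp b (ENNReal.ofReal p) μ) :
    HasDerivAt (fun θ : ℝ => ∫ x, |θ * a x + b x| ^ p ∂μ)
      (p * ∫ x, a x * signedPow (b x) (p - 1) ∂μ) 0 := by
  have hp0 : 0 < p := by linarith
  have key := hasDerivAt_integral_of_dominated_loc_of_deriv_le (μ := μ) (x₀ := (0 : ℝ))
    (s := Metric.ball 0 1) (F := fun θ x => |θ * a x + b x| ^ p)
    (F' := fun θ x => p * (a x * signedPow (θ * a x + b x) (p - 1)))
    (bound := fun x => p * (|a x| + |b x|) ^ p)
    (Metric.ball_mem_nhds 0 one_pos)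
    (.of_forall fun θ => by
      have := (ha.1.const_mul θ).add hb.1
      exact (this.aemeasurable.norm.pow_const p).aestronglyMeasurable)
    (by simpa using integrable_abs_rpow_of_memLp hp0 hb)
    (by simpa using ((integrable_mul_signedPow hp.le ha hb).const_mul p).1)
    (.of_forall fun x θ hθ => ?_)
    ((integrable_abs_add_abs_rpow hp0 ha hb).const_mul p)
    (.of_forall fun x θ _ => hasDerivAt_abs_mul_add_rpow hp _ _ _)
  · have h := key.2
    simp only [zero_mul, zero_add, integral_const_mul] at h
    exact h
  · rw [norm_mul, Real.norm_of_nonneg hp0.le]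
    gcongr
    refine abs_mul_signedPow_le hp.le ((abs_add_le _ _).trans ?_)
    rw [abs_mul]
    have : |θ| < 1 := by simpa using hθ
    nlinarith [abs_nonneg (a x)]

end Integral

/-! ### Construction of a spectral measure. -/

theorem continuous_abs_inner_rpow {m : ℕ} {α : ℝ} (hα : 0 < α) (θ : EuclideanSpace ℝ (Fin m)) :
    Continuous fun s : UnitSphere m => |inner ℝ θ (s : EuclideanSpace ℝ (Fin m))| ^ α := by
  refine Continuous.rpow_const (by fun_prop) fun _ => Or.inr hα.le

/-- Polar decomposition: push `‖W‖^α μ` forward under `W/‖W‖`. By homogeneity the density restores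
the factor lost in normalising. Averaging with the antipodal image makes the measure symmetric
without changing integrals of even functions. -/
theorem exists_symmetric_measure_sphere {S : Type*} [MeasurableSpace S] {μ : Measure S} {m : ℕ}
    [Nonempty (UnitSphere m)] {α : ℝ} (hα : 0 < α) {W : S → EuclideanSpace ℝ (Fin m)}
    (hW : Measurable W) (hint : Integrable (fun x => ‖W x‖ ^ α) μ) :
    ∃ Γ : Measure (UnitSphere m), IsFiniteMeasure Γ ∧ Γ.map (fun s => -s) = Γ ∧
      ∀ θ : EuclideanSpace ℝ (Fin m),
        ∫ s, |inner ℝ θ (s : EuclideanSpace ℝ (Fin m))| ^ α ∂Γ =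
          ∫ x, |inner ℝ θ (W x)| ^ α ∂μ := by
  classical
  obtain ⟨e⟩ := ‹Nonempty (UnitSphere m)›
  -- Where `W = 0` the density vanishes, so the direction chosen there is immaterial.
  let n : S → EuclideanSpace ℝ (Fin m) := fun x => if W x = 0 then e.1 else ‖W x‖⁻¹ • W x
  have hn : ∀ x, n x ∈ Metric.sphere (0 : EuclideanSpace ℝ (Fin m)) 1 := fun x => by
    by_cases h : W x = 0
    · simp [n, h]
    · simp [n, h, norm_smul]
  let N : S → UnitSphere m := fun x => ⟨n x, hn x⟩
  have hN : Measurable N :=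
    (Measurable.ite (hW (measurableSet_singleton 0)) measurable_const
      (hW.norm.inv.smul hW)).subtype_mk
  have hd : Measurable fun x => ENNReal.ofReal (‖W x‖ ^ α) :=
    (hW.norm.pow_const α).ennreal_ofReal
  have hneg : Measurable fun s : UnitSphere m => -s := continuous_neg.measurable
  have hfin : IsFiniteMeasure (μ.withDensity fun x => ENNReal.ofReal (‖W x‖ ^ α)) := by
    refine isFiniteMeasure_withDensity_ofReal hint.2
  let Γ₀ := (μ.withDensity fun x => ENNReal.ofReal (‖W x‖ ^ α)).map N
  have hint0 : ∀ θ : EuclideanSpace ℝ (Fin m),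
      ∫ s, |inner ℝ θ (s : EuclideanSpace ℝ (Fin m))| ^ α ∂Γ₀ =
        ∫ x, |inner ℝ θ (W x)| ^ α ∂μ := fun θ => by
    rw [integral_map hN.aemeasurable
      (continuous_abs_inner_rpow hα θ).aestronglyMeasurable,
      integral_withDensity_eq_integral_toReal_smul hd (.of_forall fun _ => ENNReal.ofReal_lt_top)]
    refine integral_congr_ae (.of_forall fun x => ?_)
    simp only [smul_eq_mul]
    rw [ENNReal.toReal_ofReal (by positivity)]
    by_cases h : W x = 0
    · simp [h, Real.zero_rpow hα.ne']
    · have h' : 0 < ‖W x‖ := norm_pos_iff.2 h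
      simp only [N, n, h, if_false]
      rw [← Real.mul_rpow h'.le (abs_nonneg _), inner_smul_right, abs_mul, abs_of_pos
        (inv_pos.2 h'), ← mul_assoc, mul_inv_cancel₀ h'.ne', one_mul]
  have hΓ₀ : IsFiniteMeasure Γ₀ := by infer_instance
  have hΓ₁ : IsFiniteMeasure (Γ₀.map fun s => -s) := by infer_instance
  refine ⟨(2⁻¹ : ENNReal) • (Γ₀ + Γ₀.map fun s => -s),
    Measure.smul_finite _ (by simp), ?_, fun θ => ?_⟩
  · rw [Measure.map_smul, Measure.map_add _ _ hneg, Measure.map_map hneg hneg, add_comm]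
    congr 2
    convert! Measure.map_id
    ext; simp
  · have hi : ∀ (ν : Measure (UnitSphere m)) [IsFiniteMeasure ν],
        Integrable (fun s : UnitSphere m =>
          |inner ℝ θ (s : EuclideanSpace ℝ (Fin m))| ^ α) ν := fun ν _ =>
      (continuous_abs_inner_rpow hα θ).integrable_of_hasCompactSupport
        (HasCompactSupport.of_compactSpace _)
    rw [integral_smul_measure, integral_add_measure (hi _) (hi _), integral_map hneg.aemeasurable
      (continuous_abs_inner_rpow hα θ).aestronglyMeasurable]
    simp only [Metric.sphere, coe_neg_sphere, inner_neg_right, abs_neg]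
    have := hint0 θ
    simp only [ENNReal.toReal_inv, ENNReal.toReal_ofNat, smul_eq_mul]
    linarith

/-! ### Moments of a real symmetric stable variable. -/

section StableReal

variable {Ω : Type*} [MeasurableSpace Ω] {P : Measure Ω} [IsProbabilityMeasure P] {α c d q : ℝ}
  {U V : Ω → ℝ}

/-- The truncation inequality bounds the tail at `r` by the integral of `1 - φ` over `[-2/r, 2/r]`,
and `1 - e^{-x} ≤ x`. -/
theorem measureReal_abs_gt_le_of_charFun {μ : Measure ℝ} [IsProbabilityMeasure μ] (hα : 0 < α)
    (hc : 0 ≤ c) (h : ∀ t, charFun μ t = Complex.exp (-((c * |t| ^ α : ℝ) : ℂ))) {r : ℝ}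
    (hr : 0 < r) : μ.real {x | r < |x|} ≤ 2 * c * 2 ^ α * r ^ (-α) := by
  refine (measureReal_abs_gt_le_integral_charFun hr).trans ?_
  have hb : ‖∫ t in (-2 * r⁻¹)..(2 * r⁻¹), 1 - charFun μ t‖ ≤
      (c * (2 * r⁻¹) ^ α) * |2 * r⁻¹ - (-2 * r⁻¹)| := by
    refine intervalIntegral.norm_integral_le_of_norm_le_const fun t ht => ?_
    have hr' : 0 < r⁻¹ := inv_pos.2 hr
    rw [Set.uIoc_of_le (by linarith)] at ht
    have ht' : |t| ≤ 2 * r⁻¹ := abs_le.2 ⟨by linarith [ht.1], ht.2⟩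
    have h0 : 0 ≤ c * |t| ^ α := by positivity
    rw [h, ← Complex.ofReal_neg, ← Complex.ofReal_exp, ← Complex.ofReal_one, ← Complex.ofReal_sub,
      Complex.norm_real, Real.norm_of_nonneg
        (by linarith [Real.exp_le_one_iff.2 (neg_nonpos.2 h0)])]
    calc 1 - Real.exp (-(c * |t| ^ α)) ≤ c * |t| ^ α := by
          linarith [Real.add_one_le_exp (-(c * |t| ^ α))]
      _ ≤ _ := by gcongr
  calc _ ≤ 2⁻¹ * r * ((c * (2 * r⁻¹) ^ α) * |2 * r⁻¹ - (-2 * r⁻¹)|) := by gcongr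
    _ = 2 * c * 2 ^ α * r ^ (-α) := by
      have : 2 * r⁻¹ - (-2 * r⁻¹) = 4 * r⁻¹ := by ring
      rw [this, abs_of_pos (by positivity), Real.mul_rpow (by norm_num) (by positivity),
        Real.inv_rpow hr.le, Real.rpow_neg hr.le]
      field_simp
      ring

/-- Layer cake: `∫ t^(q-1) P(|V| > t) dt` converges at `0` because `q > 0`, and at infinity because
the tail is `O(t^(-α))` with `q < α`. -/
theorem memLp_of_charFun (hα : 0 < α) (hc : 0 ≤ c) (hq : 0 < q) (hqα : q < α)
    (hV : AEMeasurable V P)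
    (h : ∀ t, charFun (P.map V) t = Complex.exp (-((c * |t| ^ α : ℝ) : ℂ))) :
    MemLp V (ENNReal.ofReal q) P := by
  have := Measure.isProbabilityMeasure_map hV
  have hid : MemLp (fun x : ℝ => x) (ENNReal.ofReal q) (P.map V) := by
    set μ := P.map V
    rw [← integrable_norm_rpow_iff (by fun_prop)
      (by simpa using hq) (by simp),
      ENNReal.toReal_ofReal hq.le]
    refine ⟨(measurable_norm.pow_const q).aestronglyMeasurable, ?_⟩
    rw [hasFiniteIntegral_iff_ofReal (.of_forall fun x => by positivity)]
    simp only [Real.norm_eq_abs]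
    rw [lintegral_rpow_eq_lintegral_meas_lt_mul μ (f := fun x : ℝ => |x|)
      (.of_forall fun x => abs_nonneg x) measurable_norm.aemeasurable hq]
    refine ENNReal.mul_lt_top ENNReal.ofReal_lt_top ?_
    rw [← Set.Ioc_union_Ioi_eq_Ioi zero_le_one]
    refine (lintegral_union_le _ _ _).trans_lt (ENNReal.add_lt_top.2 ⟨?_, ?_⟩)
    · have hi : IntegrableOn (fun t : ℝ => t ^ (q - 1)) (Set.Ioc 0 1) := by
        rw [← intervalIntegrable_iff_integrableOn_Ioc_of_le zero_le_one]
        exact intervalIntegral.intervalIntegrable_rpow' (by linarith)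
      refine (lintegral_mono fun t => ?_).trans_lt hi.lintegral_lt_top
      exact mul_le_of_le_one_left zero_le prob_le_one
    · have hi : IntegrableOn (fun t : ℝ => 2 * c * 2 ^ α * t ^ (q - 1 - α)) (Set.Ioi 1) :=
        (integrableOn_Ioi_rpow_of_lt (by linarith) one_pos).const_mul _
      refine (setLIntegral_mono' measurableSet_Ioi fun t ht => ?_).trans_lt hi.lintegral_lt_top
      have ht0 : (0 : ℝ) < t := one_pos.trans ht
      rw [← ofReal_measureReal, ← ENNReal.ofReal_mul measureReal_nonneg]
      refine ENNReal.ofReal_le_ofReal ?_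
      calc _ ≤ 2 * c * 2 ^ α * t ^ (-α) * t ^ (q - 1) := by
            gcongr
            exact measureReal_abs_gt_le_of_charFun hα hc h ht0
        _ = _ := by
            rw [mul_assoc, ← Real.rpow_add ht0]; ring_nf
  exact (memLp_map_measure_iff (by fun_prop) hV).1 hid

/-- `U` has the law of `k V` with `k = (c/d)^(1/α)`. Equality of laws is enough, so no integrability
is needed. -/
theorem integral_abs_rpow_eq_of_charFun (hα : 0 < α) (hc : 0 ≤ c) (hd : 0 < d)
    (hU : AEMeasurable U P) (hV : AEMeasurable V P)
    (hUc : ∀ t, charFun (P.map U) t = Complex.exp (-((c * |t| ^ α : ℝ) : ℂ)))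
    (hVd : ∀ t, charFun (P.map V) t = Complex.exp (-((d * |t| ^ α : ℝ) : ℂ))) :
    ∫ ω, |U ω| ^ q ∂P = (c / d) ^ (q / α) * ∫ ω, |V ω| ^ q ∂P := by
  set k := (c / d) ^ (1 / α) with hk
  have hk0 : 0 ≤ k := by positivity
  have hkα : k ^ α = c / d := by
    rw [hk, ← Real.rpow_mul (by positivity), one_div_mul_cancel hα.ne', Real.rpow_one]
  have hkq : k ^ q = (c / d) ^ (q / α) := by
    rw [hk, ← Real.rpow_mul (by positivity)]; congr 1; ring
  have hkV : AEMeasurable (fun ω => k * V ω) P := hV.const_mul k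
  have := Measure.isProbabilityMeasure_map hU
  have := Measure.isProbabilityMeasure_map hkV
  have hlaw : P.map U = P.map (fun ω => k * V ω) := by
    refine Measure.ext_of_charFun (funext fun t => ?_)
    rw [charFun_map_mul_comp hV, hUc, hVd, abs_mul, abs_of_nonneg hk0,
      Real.mul_rpow hk0 (abs_nonneg t), hkα]
    congr 3
    field_simp
  have hm : ∀ ν : Measure ℝ, AEStronglyMeasurable (fun x : ℝ => |x| ^ q) ν := fun ν =>
    (measurable_norm.pow_const q).aestronglyMeasurable
  calc ∫ ω, |U ω| ^ q ∂P = ∫ x, |x| ^ q ∂(P.map U) := (integral_map hU (hm _)).symm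
    _ = ∫ ω, |k * V ω| ^ q ∂P := by rw [hlaw, integral_map hkV (hm _)]
    _ = _ := by
      rw [← integral_const_mul]
      refine integral_congr_ae (.of_forall fun ω => ?_)
      simp only
      rw [abs_mul, abs_of_nonneg hk0, Real.mul_rpow hk0 (abs_nonneg _), hkq]

end StableReal

theorem aemeasurable_pair {Ω : Type*} [MeasurableSpace Ω] {P : Measure Ω} {X Y : Ω → ℝ}
    (hX : AEMeasurable X P) (hY : AEMeasurable Y P) : AEMeasurable (pair X Y) P := by
  refine (WithLp.measurable_toLp 2 _).comp_aemeasurable (aemeasurable_pi_iff.2 fun i => ?_)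
  fin_cases i
  · exact hX
  · exact hY

theorem inner_euclidean_two (θ v : EuclideanSpace ℝ (Fin 2)) :
    inner ℝ θ v = θ 0 * v 0 + θ 1 * v 1 := by
  simp [PiLp.inner_apply, Fin.sum_univ_two, mul_comm]

theorem memLp_sphere_coord {m : ℕ} (Γ : Measure (UnitSphere m)) [IsFiniteMeasure Γ] (i : Fin m)
    (p : ENNReal) : MemLp (fun s : UnitSphere m => s.1 i) p Γ := by
  refine MemLp.of_bound (C := 1) ?_ (.of_forall fun s => ?_)
  · exact (Continuous.aestronglyMeasurable (by fun_prop))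
  · exact (PiLp.norm_apply_le s.1 i).trans (by simp)

/-! ### Covariation read off from a representation of the joint exponent. -/

section Covariation

variable {Ω : Type*} [MeasurableSpace Ω] {P : Measure Ω} {α q : ℝ}
  {X Y : Ω → ℝ} {S : Type*} [MeasurableSpace S] {μ : Measure S} {a b : S → ℝ}

theorem IsSymStable.integral_eq {Γ : Measure (UnitSphere 2)}
    (hΓ : IsSymStable α P (pair X Y) Γ)
    (h : ∀ θ : EuclideanSpace ℝ (Fin 2), charFun (P.map (pair X Y)) θ =
      Complex.exp (-((∫ x, |θ 0 * a x + θ 1 * b x| ^ α ∂μ : ℝ) : ℂ))) (c d : ℝ) :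
    ∫ s, |c * s.1 0 + d * s.1 1| ^ α ∂Γ = ∫ x, |c * a x + d * b x| ^ α ∂μ := by
  have h1 := hΓ.charFun_eq !₂[c, d]
  rw [h] at h1
  simp only [inner_euclidean_two] at h1
  rw [← Complex.ofReal_neg, ← Complex.ofReal_neg, ← Complex.ofReal_exp, ← Complex.ofReal_exp,
    Complex.ofReal_inj, Real.exp_eq_exp, neg_inj] at h1
  simpa using h1.symm

/-- The exponents of the two representations agree along the line `(θ, 1)`, hence so do their
derivatives at `θ = 0`. -/
theorem IsSymStable.spectralCovariation_eq (hα : 1 < α) {Γ : Measure (UnitSphere 2)}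
    (hΓ : IsSymStable α P (pair X Y) Γ) (ha : MemLp a (ENNReal.ofReal α) μ)
    (hb : MemLp b (ENNReal.ofReal α) μ)
    (h : ∀ θ : EuclideanSpace ℝ (Fin 2), charFun (P.map (pair X Y)) θ =
      Complex.exp (-((∫ x, |θ 0 * a x + θ 1 * b x| ^ α ∂μ : ℝ) : ℂ))) :
    spectralCovariation α Γ = ∫ x, a x * signedPow (b x) (α - 1) ∂μ := by
  have := hΓ.finite
  have h1 := hasDerivAt_integral_abs_mul_add_rpow hα (memLp_sphere_coord Γ 0 _)
    (memLp_sphere_coord Γ 1 _)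
  have h2 := hasDerivAt_integral_abs_mul_add_rpow hα ha hb
  have h3 : (fun θ : ℝ => ∫ s : UnitSphere 2, |θ * s.1 0 + s.1 1| ^ α ∂Γ) =
      fun θ => ∫ x, |θ * a x + b x| ^ α ∂μ := by
    funext θ
    simpa using hΓ.integral_eq h θ 1
  rw [h3] at h1
  exact mul_left_cancel₀ (by linarith) (h1.unique h2)

theorem charFun_mul_add (hX : AEMeasurable X P) (hY : AEMeasurable Y P)
    (h : ∀ θ : EuclideanSpace ℝ (Fin 2), charFun (P.map (pair X Y)) θ =
      Complex.exp (-((∫ x, |θ 0 * a x + θ 1 * b x| ^ α ∂μ : ℝ) : ℂ))) (c d t : ℝ) :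
    charFun (P.map fun ω => c * X ω + d * Y ω) t =
      Complex.exp (-((((∫ x, |c * a x + d * b x| ^ α ∂μ) * |t| ^ α : ℝ)) : ℂ)) := by
  have h1 := h !₂[t * c, t * d]
  have h2 : ∫ x, |t * c * a x + t * d * b x| ^ α ∂μ =
      (∫ x, |c * a x + d * b x| ^ α ∂μ) * |t| ^ α := by
    rw [← integral_mul_const]
    refine integral_congr_ae (.of_forall fun x => ?_)
    simp only
    rw [← Real.mul_rpow (abs_nonneg _) (abs_nonneg _), ← abs_mul]
    congr 2; ring
  simp only [Matrix.cons_val_zero, Matrix.cons_val_one] at h1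
  rw [← h2, ← h1, charFun_apply, charFun_apply, integral_map (by fun_prop) (by fun_prop),
    integral_map (aemeasurable_pair hX hY) (by fun_prop)]
  refine integral_congr_ae (.of_forall fun ω => ?_)
  simp only [inner_euclidean_two, pair]
  congr 3
  simp
  ring

variable [IsProbabilityMeasure P]

/-- Two expressions for the derivative of `E|θX + Y|^q` at `0`: directly, and by scaling `θX + Y` to
`Y`, which turns the moment into `(∫ |θa + b|^α / ∫ |b|^α)^(q/α) E|Y|^q`. The direct one requires `q
> 1`. -/
theorem integral_mul_signedPow_eq (hα : 1 < α) (hX : AEMeasurable X P) (hY : AEMeasurable Y P)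
    (ha : MemLp a (ENNReal.ofReal α) μ) (hb : MemLp b (ENNReal.ofReal α) μ)
    (h : ∀ θ : EuclideanSpace ℝ (Fin 2), charFun (P.map (pair X Y)) θ =
      Complex.exp (-((∫ x, |θ 0 * a x + θ 1 * b x| ^ α ∂μ : ℝ) : ℂ)))
    (hσ : 0 < ∫ x, |b x| ^ α ∂μ) (hXq : MemLp X (ENNReal.ofReal q) P)
    (hYq : MemLp Y (ENNReal.ofReal q) P) (hq : 1 < q) :
    (∫ ω, X ω * signedPow (Y ω) (q - 1) ∂P) * ∫ x, |b x| ^ α ∂μ =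
      (∫ x, a x * signedPow (b x) (α - 1) ∂μ) * ∫ ω, |Y ω| ^ q ∂P := by
  set d := ∫ x, |b x| ^ α ∂μ
  set C := ∫ x, a x * signedPow (b x) (α - 1) ∂μ
  set M := ∫ ω, |Y ω| ^ q ∂P
  have hα0 : 0 < α := by linarith
  have h1 := hasDerivAt_integral_abs_mul_add_rpow hq hXq hYq
  have h2 := hasDerivAt_integral_abs_mul_add_rpow hα ha hb
  have h3 : (fun θ : ℝ => ∫ ω, |θ * X ω + Y ω| ^ q ∂P) =
      fun θ => ((∫ x, |θ * a x + b x| ^ α ∂μ) / d) ^ (q / α) * M := by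
    funext θ
    refine integral_abs_rpow_eq_of_charFun hα0 (integral_nonneg fun x => by positivity) hσ
      (by fun_prop) hY (fun t => ?_) fun t => ?_
    · simpa using charFun_mul_add hX hY h θ 1 t
    · simpa using charFun_mul_add hX hY h 0 1 t
  have h4 : HasDerivAt (fun θ : ℝ => ((∫ x, |θ * a x + b x| ^ α ∂μ) / d) ^ (q / α) * M)
      (α * C / d * (q / α) * 1 * M) 0 := by
    have h0 : (∫ x, |0 * a x + b x| ^ α ∂μ) / d = 1 := by
      simp only [zero_mul, zero_add]
      exact div_self hσ.ne'
    have := ((h2.div_const d).rpow_const (p := q / α) (Or.inl (by rw [h0]; norm_num))).mul_const M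
    rwa [h0, Real.one_rpow] at this
  rw [h3] at h1
  have h5 := h1.unique h4
  field_simp at h5
  linarith

/-- Supplies the case `q = 1` of the moment formula, where `y ↦ |y|^q` is not differentiable at `0`.
-/
theorem tendsto_integral_mul_signedPow_one {p : ℝ} (hp : 1 < p)
    (hX : MemLp X (ENNReal.ofReal p) P) (hY : MemLp Y (ENNReal.ofReal p) P) :
    Filter.Tendsto (fun q => ∫ ω, X ω * signedPow (Y ω) (q - 1) ∂P) (𝓝[>] 1)
      (𝓝 (∫ ω, X ω * signedPow (Y ω) (1 - 1) ∂P)) := by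
  have hX1 : MemLp X (ENNReal.ofReal 1) P :=
    hX.mono_exponent (ENNReal.ofReal_le_ofReal hp.le)
  refine tendsto_integral_filter_of_dominated_convergence
    (fun ω => |X ω| ^ (1 : ℝ) + (|X ω| + |Y ω|) ^ p) (.of_forall fun q => ?_) ?_ ?_
    (.of_forall fun ω => ?_)
  · exact hX.1.mul
      ((measurable_signedPow _).comp_aemeasurable hY.1.aemeasurable).aestronglyMeasurable
  · filter_upwards [Ioo_mem_nhdsGT hp] with q hq
    refine .of_forall fun ω => ?_
    rw [Real.norm_eq_abs, abs_mul, Real.rpow_one]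
    have h1 : |signedPow (Y ω) (q - 1)| ≤ 1 + |Y ω| ^ (p - 1) := by
      refine (abs_signedPow_le _ _).trans ?_
      rcases le_total |Y ω| 1 with h | h
      · have := Real.rpow_le_one (abs_nonneg _) h (by linarith [hq.1] : 0 ≤ q - 1)
        have : 0 ≤ |Y ω| ^ (p - 1) := by positivity
        linarith
      · have := Real.rpow_le_rpow_of_exponent_le h (by linarith [hq.2] : q - 1 ≤ p - 1)
        linarith
    have h2 : |X ω| * |Y ω| ^ (p - 1) ≤ (|X ω| + |Y ω|) ^ p := by
      rcases eq_or_ne (Y ω) 0 with h0 | h0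
      · rw [h0, abs_zero, Real.zero_rpow (by linarith), mul_zero]; positivity
      · have := abs_mul_signedPow_le hp.le (x := X ω) (y := Y ω) (z := Y ω)
          (by linarith [abs_nonneg (X ω)])
        rw [signedPow, abs_mul, abs_mul, abs_of_nonneg (Real.rpow_nonneg (abs_nonneg (Y ω)) _)]
          at this
        have hs : |Real.sign (Y ω)| = 1 := by
          rcases Real.sign_apply_eq_of_ne_zero _ h0 with h | h <;> simp [h]
        simpa [hs] using this
    calc |X ω| * |signedPow (Y ω) (q - 1)| ≤ |X ω| * (1 + |Y ω| ^ (p - 1)) := by gcongr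
      _ ≤ _ := by linarith
  · exact (integrable_abs_rpow_of_memLp one_pos hX1).add
      (integrable_abs_add_abs_rpow (by linarith) hX hY)
  · refine Filter.Tendsto.const_mul _ ?_
    -- At `Y = 0` the power `|Y|^(q-1)` jumps to `0^0 = 1` at `q = 1`, but the factor `sign 0 = 0`
    -- removes the jump.
    rcases eq_or_ne (Y ω) 0 with h0 | h0
    · simp only [h0, signedPow_zero]; exact tendsto_const_nhds
    · unfold signedPow
      have : ContinuousAt (fun q : ℝ => |Y ω| ^ (q - 1) * Real.sign (Y ω)) 1 := by
        have := (Real.continuousAt_const_rpow (b := (1 : ℝ) - 1) (abs_ne_zero.2 h0)).comp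
          (f := fun q : ℝ => q - 1) (by fun_prop)
        exact this.mul continuousAt_const
      exact this.tendsto.mono_left nhdsWithin_le_nhds

theorem abs_rpow_eq_mul_signedPow {y q : ℝ} (hq : 1 ≤ q) :
    |y| ^ q = y * signedPow y (q - 1) := by
  rcases eq_or_ne y 0 with h0 | h0
  · simp [h0, Real.zero_rpow (by linarith : q ≠ 0)]
  · have h : |y| ^ q = |y| ^ (q - 1) * |y| := by
      rw [← Real.rpow_add_one (abs_ne_zero.2 h0)]; congr 1; ring
    rw [h, signedPow]
    rcases lt_or_gt_of_ne h0 with h0 | h0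
    · rw [abs_of_neg h0, Real.sign_of_neg h0]; ring
    · rw [abs_of_pos h0, Real.sign_of_pos h0]; ring

theorem hasCovariation_of_charFun (hα : 1 < α) (hX : AEMeasurable X P) (hY : AEMeasurable Y P)
    (hma : Measurable a) (hmb : Measurable b)
    (ha : MemLp a (ENNReal.ofReal α) μ) (hb : MemLp b (ENNReal.ofReal α) μ)
    (h : ∀ θ : EuclideanSpace ℝ (Fin 2), charFun (P.map (pair X Y)) θ =
      Complex.exp (-((∫ x, |θ 0 * a x + θ 1 * b x| ^ α ∂μ : ℝ) : ℂ))) :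
    HasCovariation α P X Y (∫ x, a x * signedPow (b x) (α - 1) ∂μ) := by
  have hα0 : 0 < α := by linarith
  have hchX : ∀ t, charFun (P.map X) t =
      Complex.exp (-(((∫ x, |a x| ^ α ∂μ) * |t| ^ α : ℝ) : ℂ)) := fun t => by
    simpa using charFun_mul_add hX hY h 1 0 t
  have hchY : ∀ t, charFun (P.map Y) t =
      Complex.exp (-(((∫ x, |b x| ^ α ∂μ) * |t| ^ α : ℝ) : ℂ)) := fun t => by
    simpa using charFun_mul_add hX hY h 0 1 t
  have hXq : ∀ q, 1 ≤ q → q < α → MemLp X (ENNReal.ofReal q) P := fun q h1 h2 =>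
    memLp_of_charFun hα0 (integral_nonneg fun x => by positivity) (by linarith) h2 hX hchX
  have hYq : ∀ q, 1 ≤ q → q < α → MemLp Y (ENNReal.ofReal q) P := fun q h1 h2 =>
    memLp_of_charFun hα0 (integral_nonneg fun x => by positivity) (by linarith) h2 hY hchY
  have hσ0 : 0 ≤ ∫ x, |b x| ^ α ∂μ := integral_nonneg fun x => by positivity
  refine ⟨?_, fun Γ hΓ => hΓ.spectralCovariation_eq hα ha hb h,
    fun q h1 h2 => integrable_mul_signedPow h1 (hXq q h1 h2) (hYq q h1 h2),
    fun q h1 h2 => integrable_abs_rpow_of_memLp (by linarith) (hYq q h1 h2),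
    fun Γ hΓ q h1 h2 => ?_⟩
  · have hne : Nonempty (UnitSphere 2) :=
      ⟨⟨EuclideanSpace.single 0 1, by simp⟩⟩
    have hW : Measurable fun x => (!₂[a x, b x] : EuclideanSpace ℝ (Fin 2)) := by
      refine (WithLp.measurable_toLp 2 _).comp (measurable_pi_iff.2 fun i => ?_)
      fin_cases i
      · exact hma
      · exact hmb
    have hint : Integrable (fun x => ‖(!₂[a x, b x] : EuclideanSpace ℝ (Fin 2))‖ ^ α) μ := by
      refine (integrable_abs_add_abs_rpow hα0 ha hb).mono'
        (hW.norm.pow_const α).aestronglyMeasurable (.of_forall fun x => ?_)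
      rw [Real.norm_of_nonneg (by positivity)]
      gcongr
      rw [EuclideanSpace.norm_eq]
      refine Real.sqrt_le_iff.2 ⟨by positivity, ?_⟩
      simp only [Fin.sum_univ_two, Matrix.cons_val_zero, Matrix.cons_val_one, Real.norm_eq_abs]
      nlinarith [abs_nonneg (a x), abs_nonneg (b x)]
    obtain ⟨Γ, hfin, hsymm, hΓ⟩ := exists_symmetric_measure_sphere hα0 hW hint
    refine ⟨Γ, aemeasurable_pair hX hY, hfin, hsymm, fun θ => ?_⟩
    rw [h, hΓ]
    simp [inner_euclidean_two]
  · have hscale : scaleSnd α Γ ^ α = ∫ x, |b x| ^ α ∂μ := by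
      have h1 : ∫ s : UnitSphere 2, |s.1 1| ^ α ∂Γ = ∫ x, |b x| ^ α ∂μ := by
        simpa using hΓ.integral_eq h 0 1
      rw [scaleSnd, h1, ← Real.rpow_mul hσ0, one_div_mul_cancel hα0.ne', Real.rpow_one]
    rw [momentCovariation, hscale]
    -- If `σ_Y = 0`, then `b = 0` almost everywhere and both sides are `0`.
    rcases hσ0.eq_or_lt with h0 | hσ
    · rw [← h0, mul_zero, zero_div]
      symm
      refine integral_eq_zero_of_ae ?_
      have := (integral_eq_zero_iff_of_nonneg (fun x => by positivity)
        (integrable_abs_rpow_of_memLp hα0 hb)).1 h0.symm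
      filter_upwards [this] with x hx
      have hbx : b x = 0 := by
        simpa [Real.rpow_eq_zero (abs_nonneg _) hα0.ne'] using hx
      simp [hbx, signedPow_zero]
    -- Otherwise `Y = 0` almost surely, and its characteristic function at `1` would be `1` instead
    -- of `exp(-∫ |b|^α) < 1`.
    · have hM : ∫ ω, |Y ω| ^ q ∂P ≠ 0 := fun h0 => by
        have h3 := (integral_eq_zero_iff_of_nonneg (fun x => by positivity)
          (integrable_abs_rpow_of_memLp (by linarith) (hYq q h1 h2))).1 h0
        have hY0 : Y =ᵐ[P] fun _ => 0 := by
          filter_upwards [h3] with ω hω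
          simpa [Real.rpow_eq_zero (abs_nonneg _) (by linarith : q ≠ 0)] using hω
        have h4 := hchY 1
        rw [Measure.map_congr hY0] at h4
        simp only [Measure.map_const, measure_univ, one_smul, charFun_dirac, inner_zero_left,
          abs_one, Real.one_rpow, mul_one, Complex.ofReal_zero, zero_mul, Complex.exp_zero] at h4
        rw [← Complex.ofReal_neg, ← Complex.ofReal_exp, ← Complex.ofReal_one, Complex.ofReal_inj]
          at h4
        rw [eq_comm, Real.exp_eq_one_iff] at h4
        linarith
      rw [div_eq_iff hM]
      rcases h1.eq_or_lt with h1 | h1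
      · subst h1
        obtain ⟨p, hp1, hpα⟩ := exists_between hα
        have t1 := (tendsto_integral_mul_signedPow_one hp1 (hXq p hp1.le hpα)
          (hYq p hp1.le hpα)).mul_const (∫ x, |b x| ^ α ∂μ)
        have t2 := (tendsto_integral_mul_signedPow_one hp1 (hYq p hp1.le hpα)
          (hYq p hp1.le hpα)).const_mul (∫ x, a x * signedPow (b x) (α - 1) ∂μ)
        -- Writing `|Y|^q = Y Y^⟨q-1⟩` makes continuity of `E|Y|^q` as `q ↓ 1` the case `X = Y` of
        -- the same limit lemma.
        have e : ∀ q, 1 ≤ q → ∫ ω, |Y ω| ^ q ∂P = ∫ ω, Y ω * signedPow (Y ω) (q - 1) ∂P :=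
          fun q hq => integral_congr_ae (.of_forall fun ω => abs_rpow_eq_mul_signedPow hq)
        rw [e 1 le_rfl]
        refine tendsto_nhds_unique t1 (t2.congr' ?_)
        filter_upwards [Ioo_mem_nhdsGT hα] with q hq
        rw [← e q hq.1.le, integral_mul_signedPow_eq hα hX hY ha hb h hσ (hXq q hq.1.le hq.2)
          (hYq q hq.1.le hq.2) hq.1]
      · exact integral_mul_signedPow_eq hα hX hY ha hb h hσ (hXq q h1.le h2) (hYq q h1.le h2) h1

end Covariation

/-! ### Summability and integrals over countably many copies of a measure. -/

theorem summable_rpow_of_summable {ι : Type*} {f : ι → ℝ} {α : ℝ} (hα : 1 ≤ α)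
    (h0 : ∀ u, 0 ≤ f u) (hf : Summable f) : Summable fun u => f u ^ α := by
  refine Summable.of_norm_bounded_eventually hf ?_
  filter_upwards [hf.tendsto_cofinite_zero.eventually (gt_mem_nhds one_pos)] with u hu
  rw [Real.norm_of_nonneg (Real.rpow_nonneg (h0 u) α)]
  exact Real.rpow_le_self_of_le_one (h0 u) hu.le hα

theorem euclidean_norm_le_sum_abs {m : ℕ} (v : EuclideanSpace ℝ (Fin m)) :
    ‖v‖ ≤ ∑ k, |v k| := by
  rw [EuclideanSpace.norm_eq]
  refine Real.sqrt_le_iff.2 ⟨Finset.sum_nonneg fun _ _ => abs_nonneg _, ?_⟩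
  exact Finset.sum_sq_le_sq_sum_of_nonneg fun _ _ => abs_nonneg _

section SumMeasure

variable {ι S : Type*} [MeasurableSpace ι] [MeasurableSpace S] {Γ : Measure S} {f : ι × S → ℝ}

theorem integrable_sum_map_mk [Countable ι] [IsFiniteMeasure Γ] (hf : Measurable f) {K : ι → ℝ}
    (hK : Summable K) (hfK : ∀ u x, |f (u, x)| ≤ K u) :
    Integrable f (Measure.sum fun u => Γ.map (Prod.mk u)) := by
  have hi : ∀ u, Integrable (fun x => f (u, x)) Γ := fun u =>
    Integrable.of_bound (hf.comp measurable_prodMk_left).aestronglyMeasurable (K u)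
      (.of_forall fun x => hfK u x)
  refine integrable_sum_measure_iff.2 ⟨fun u => ?_, ?_⟩
  · exact (integrable_map_measure hf.aestronglyMeasurable
      measurable_prodMk_left.aemeasurable).2 (hi u)
  · refine Summable.of_nonneg_of_le (fun u => integral_nonneg fun x => norm_nonneg _) (fun u => ?_)
      (hK.mul_right (Γ.real Set.univ))
    rw [integral_map measurable_prodMk_left.aemeasurable hf.norm.aestronglyMeasurable]
    calc ∫ x, ‖f (u, x)‖ ∂Γ ≤ ∫ _, K u ∂Γ :=
          integral_mono (hi u).norm (integrable_const _) fun x => hfK u x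
      _ = K u * Γ.real Set.univ := by simp [mul_comm]

theorem hasSum_integral_sum_map_mk (hf : Measurable f)
    (hi : Integrable f (Measure.sum fun u => Γ.map (Prod.mk u))) :
    HasSum (fun u => ∫ x, f (u, x) ∂Γ) (∫ z, f z ∂(Measure.sum fun u => Γ.map (Prod.mk u))) := by
  convert! hasSum_integral_measure hi using 2 with u
  exact (integral_map measurable_prodMk_left.aemeasurable hf.aestronglyMeasurable).symm

end SumMeasure

/-! ### Series of independent stable vectors. -/

section MovingAverage

variable {Ω ι : Type*} [MeasurableSpace Ω] {P : Measure Ω} [Countable ι]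
  {m : ℕ} {α : ℝ} {Γ : Measure (UnitSphere m)} {Z : ι → Ω → EuclideanSpace ℝ (Fin m)}

theorem aemeasurable_of_hasSum_inner (hZ : ∀ u, Measurable (Z u))
    {c : ι → EuclideanSpace ℝ (Fin m)} {V : Ω → ℝ}
    (hV : ∀ᵐ ω ∂P, HasSum (fun u => inner ℝ (c u) (Z u ω)) (V ω)) : AEMeasurable V P :=
  aemeasurable_of_tendsto_metrizable_ae Filter.atTop
    (f := fun (F : Finset ι) ω => ∑ u ∈ F, inner ℝ (c u) (Z u ω))
    (fun F => (Finset.measurable_fun_sum F fun u _ => (hZ u).const_inner).aemeasurable) hV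

variable [IsProbabilityMeasure P]

/-- Finite partial sums factor by independence, and almost sure convergence passes to characteristic
functions by dominated convergence. The argument `1` suffices because `c` is arbitrary and absorbs
any frequency. -/
theorem charFun_of_hasSum_inner (hZ : ∀ u, Measurable (Z u)) (hind : iIndepFun Z P)
    (hst : ∀ u, IsSymStable α P (Z u) Γ) {c : ι → EuclideanSpace ℝ (Fin m)} {V : Ω → ℝ} {I : ℝ}
    (hV : ∀ᵐ ω ∂P, HasSum (fun u => inner ℝ (c u) (Z u ω)) (V ω))
    (hI : HasSum (fun u => ∫ x, |inner ℝ (c u) (x : EuclideanSpace ℝ (Fin m))| ^ α ∂Γ) I) :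
    charFun (P.map V) 1 = Complex.exp (-(I : ℂ)) := by
  have hm : ∀ u, Measurable fun ω => inner ℝ (c u) (Z u ω) := fun u => (hZ u).const_inner
  have hVm := aemeasurable_of_hasSum_inner hZ hV
  have h1 : ∀ u, charFun (P.map fun ω => inner ℝ (c u) (Z u ω)) 1 =
      Complex.exp (-((∫ x, |inner ℝ (c u) (x : EuclideanSpace ℝ (Fin m))| ^ α ∂Γ : ℝ) : ℂ)) :=
    fun u => by
      rw [← (hst u).charFun_eq, charFun_apply, charFun_apply,
        integral_map (hm u).aemeasurable (by fun_prop),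
        integral_map (hZ u).aemeasurable (by fun_prop)]
      simp [real_inner_comm]
  have hind' : iIndepFun (fun u ω => inner ℝ (c u) (Z u ω)) P :=
    hind.comp (fun u x => inner ℝ (c u) x) fun u => by fun_prop
  have h2 : ∀ F : Finset ι, charFun (P.map fun ω => ∑ u ∈ F, inner ℝ (c u) (Z u ω)) 1 =
      Complex.exp (-((∑ u ∈ F, ∫ x, |inner ℝ (c u) (x : EuclideanSpace ℝ (Fin m))| ^ α ∂Γ : ℝ)
        : ℂ)) := fun F => by
    rw [(hind'.restrict F).charFun_map_fun_finsetSum_eq_prod fun u _ => (hm u).aemeasurable,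
      Finset.prod_apply, Finset.prod_congr rfl fun u _ => h1 u, ← Complex.exp_sum]
    push_cast
    rw [Finset.sum_neg_distrib]
  have h3 : Filter.Tendsto
      (fun F : Finset ι => charFun (P.map fun ω => ∑ u ∈ F, inner ℝ (c u) (Z u ω)) 1)
      Filter.atTop (𝓝 (charFun (P.map V) 1)) := by
    have e : ∀ {U : Ω → ℝ}, AEMeasurable U P →
        charFun (P.map U) 1 = ∫ ω, Complex.exp (U ω * Complex.I) ∂P := fun hU => by
      rw [charFun_apply, integral_map hU (by fun_prop)]
      simp
    rw [e hVm]
    simp_rw [fun F : Finset ι =>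
      e (Finset.measurable_fun_sum F fun u _ => hm u).aemeasurable]
    refine tendsto_integral_filter_of_dominated_convergence (fun _ => 1)
      (.of_forall fun F => ?_) (.of_forall fun F => .of_forall fun ω => ?_)
      (integrable_const _) ?_
    · have := Finset.measurable_fun_sum F fun u _ => hm u
      exact Measurable.aestronglyMeasurable (by fun_prop)
    · rw [Complex.norm_exp_ofReal_mul_I]
    · filter_upwards [hV] with ω hω
      exact ((Complex.continuous_exp.comp (Complex.continuous_ofReal.mul
        continuous_const)).tendsto _).comp hω
  refine tendsto_nhds_unique h3 ?_
  simp_rw [h2]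
  exact ((Complex.continuous_exp.comp Complex.continuous_ofReal.neg).tendsto _).comp hI

theorem hasCovariation_of_hasSum_inner (hα : 1 < α) (hZ : ∀ u, Measurable (Z u))
    (hind : iIndepFun Z P) (hst : ∀ u, IsSymStable α P (Z u) Γ) [IsFiniteMeasure Γ]
    {A B : ι → EuclideanSpace ℝ (Fin m)} {X Y : Ω → ℝ}
    (hX : ∀ᵐ ω ∂P, HasSum (fun u => inner ℝ (A u) (Z u ω)) (X ω))
    (hY : ∀ᵐ ω ∂P, HasSum (fun u => inner ℝ (B u) (Z u ω)) (Y ω))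
    (hA : Summable fun u => ‖A u‖) (hB : Summable fun u => ‖B u‖) :
    ∃ C, HasSum (fun u => ∫ x : UnitSphere m, inner ℝ (A u) x.1 *
      signedPow (inner ℝ (B u) x.1) (α - 1) ∂Γ) C ∧ HasCovariation α P X Y C := by
  -- With the discrete σ-algebra on the countable index set, measurability on `ι × S_m` is
  -- measurability on each slice.
  let _ : MeasurableSpace ι := ⊤
  have hα0 : 0 < α := by linarith
  let row : (ι → EuclideanSpace ℝ (Fin m)) → ι × UnitSphere m → ℝ :=
    fun c z => inner ℝ (c z.1) z.2.1
  have hrow : ∀ c, Measurable (row c) := fun c =>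
    measurable_from_prod_countable_right fun u =>
      (Continuous.measurable (by fun_prop : Continuous fun x : UnitSphere m => inner ℝ (c u) x.1))
  set μ : Measure (ι × UnitSphere m) := Measure.sum fun u => Γ.map (Prod.mk u)
  have hle : ∀ c u x, |row c (u, x)| ≤ ‖c u‖ := fun c u x => by
    simpa using abs_real_inner_le_norm (c u) x.1
  have hrowi : ∀ c : ι → EuclideanSpace ℝ (Fin m), Summable (fun u => ‖c u‖) →
      Integrable (fun z => |row c z| ^ α) μ := fun c hc => by
    refine integrable_sum_map_mk ((hrow c).norm.pow_const α)
      (summable_rpow_of_summable hα.le (fun u => norm_nonneg _) hc) fun u x => ?_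
    rw [abs_of_nonneg (by positivity)]
    gcongr
    exact hle c u x
  have hmem : ∀ c : ι → EuclideanSpace ℝ (Fin m), Summable (fun u => ‖c u‖) →
      MemLp (row c) (ENNReal.ofReal α) μ := fun c hc => by
    rw [← integrable_norm_rpow_iff (hrow c).aestronglyMeasurable (by simpa using hα0) (by simp),
      ENNReal.toReal_ofReal hα0.le]
    exact hrowi c hc
  refine ⟨∫ z, row A z * signedPow (row B z) (α - 1) ∂μ, ?_, ?_⟩
  · exact hasSum_integral_sum_map_mk ((hrow A).mul ((measurable_signedPow _).comp (hrow B)))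
      (integrable_mul_signedPow hα.le (hmem A hA) (hmem B hB))
  · have hXm := aemeasurable_of_hasSum_inner hZ hX
    have hYm := aemeasurable_of_hasSum_inner hZ hY
    refine hasCovariation_of_charFun hα hXm hYm (hrow A) (hrow B) (hmem A hA) (hmem B hB)
      fun θ => ?_
    -- A linear combination of `X` and `Y` is again such a series, so the joint law reduces to the
    -- scalar case.
    let c : ι → EuclideanSpace ℝ (Fin m) := fun u => θ 0 • A u + θ 1 • B u
    have hc : Summable fun u => ‖c u‖ :=
      Summable.of_nonneg_of_le (fun u => norm_nonneg _) (fun u => (norm_add_le _ _).trans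
        (by rw [norm_smul, norm_smul])) ((hA.mul_left _).add (hB.mul_left _))
    have hV : ∀ᵐ ω ∂P, HasSum (fun u => inner ℝ (c u) (Z u ω)) (θ 0 * X ω + θ 1 * Y ω) := by
      filter_upwards [hX, hY] with ω h1 h2
      simpa [c, inner_add_left, inner_smul_left] using (h1.mul_left (θ 0)).add (h2.mul_left (θ 1))
    have hI := hasSum_integral_sum_map_mk ((hrow c).norm.pow_const α) (hrowi c hc)
    have hrc : ∀ z, row c z = θ 0 * row A z + θ 1 * row B z := fun z => by
      simp [row, c, inner_add_left, inner_smul_left]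
    have key := charFun_of_hasSum_inner hZ hind hst hV hI
    simp only [Real.norm_eq_abs, hrc] at key
    rw [← key, charFun_apply, charFun_apply, integral_map (aemeasurable_pair hXm hYm)
      (by fun_prop), integral_map (by fun_prop) (by fun_prop)]
    refine integral_congr_ae (.of_forall fun ω => ?_)
    simp only [inner_euclidean_two, pair]
    congr 3
    simp
    ring

end MovingAverage

/-! ### The PAR(1) solution as a series over noise times. -/

section PAR

variable {m : ℕ}

/-- The `l`-th row of the coefficient of `Z u` in the bounded solution at time `t`. -/
noncomputable def coeffRow (Θ : ℤ → Matrix (Fin m) (Fin m) ℝ) (t : ℤ) (l : Fin m) (u : ℤ) :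
    EuclideanSpace ℝ (Fin m) :=
  if u ≤ t then WithLp.toLp 2 (g Θ t (u + 1) l) else 0

/-- Lets a sum over lags `j ≥ 0` be exchanged for a sum over noise times `u = n - j`, extended by
zero to `u > n`. -/
theorem sub_natCast_injective (n : ℤ) : Function.Injective fun j : ℕ => n - (j : ℤ) :=
  fun i j h => by simpa using h

theorem lt_of_notMem_range_sub_natCast {n u : ℤ} (h : u ∉ Set.range fun j : ℕ => n - (j : ℤ)) :
    n < u := by
  by_contra hu
  exact h ⟨(n - u).toNat, by simp only; omega⟩

theorem coeffRow_of_lt (Θ : ℤ → Matrix (Fin m) (Fin m) ℝ) {t u : ℤ} (l : Fin m) (h : t < u) :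
    coeffRow Θ t l u = 0 := if_neg (not_le.2 h)

theorem inner_coeffRow (Θ : ℤ → Matrix (Fin m) (Fin m) ℝ) {t u : ℤ} (l : Fin m) (h : u ≤ t)
    (v : EuclideanSpace ℝ (Fin m)) :
    inner ℝ (coeffRow Θ t l u) v = ∑ k, g Θ t (u + 1) l k * v k := by
  rw [coeffRow, if_pos h, PiLp.inner_apply]
  simp [mul_comm]

variable {Ω : Type*} [MeasurableSpace Ω] {P : Measure Ω} {Θ : ℤ → Matrix (Fin m) (Fin m) ℝ}
  {Z X : ℤ → Ω → EuclideanSpace ℝ (Fin m)}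

theorem IsBoundedSolution.summable_norm_coeffRow (hX : IsBoundedSolution P Θ Z X) (t : ℤ)
    (l : Fin m) : Summable fun u => ‖coeffRow Θ t l u‖ := by
  refine ((sub_natCast_injective t).summable_iff fun u hu => ?_).1 ?_
  · rw [coeffRow_of_lt Θ l (lt_of_notMem_range_sub_natCast hu), norm_zero]
  · refine Summable.of_nonneg_of_le (fun j => norm_nonneg _)
      (fun j => euclidean_norm_le_sum_abs _) ?_
    refine (summable_sum (s := Finset.univ) fun k _ => hX.summable_coeff t l k).congr fun j => ?_
    simp [coeffRow]

theorem IsBoundedSolution.hasSum_inner (hX : IsBoundedSolution P Θ Z X) (t : ℤ) (l : Fin m) :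
    ∀ᵐ ω ∂P, HasSum (fun u => inner ℝ (coeffRow Θ t l u) (Z u ω)) (X t ω l) := by
  filter_upwards [hX.hasSum t] with ω hω
  refine ((sub_natCast_injective t).hasSum_iff fun u hu => ?_).1 ?_
  · rw [coeffRow_of_lt Θ l (lt_of_notMem_range_sub_natCast hu), inner_zero_left]
  · convert! hω l using 2 with j
    simp only [Function.comp_apply]
    rw [inner_coeffRow Θ l (by omega)]
    rfl

theorem hasCovariation_components [IsProbabilityMeasure P] {α : ℝ} (hα : 1 < α) {T : ℕ}
    {Γ : Measure (UnitSphere m)} (hPAR : IsStablePAR1 α T P Γ Θ Z X)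
    (hX : IsBoundedSolution P Θ Z X) (s t : ℤ) (r l : Fin m) {n : ℤ} (hn : n = min s t) :
    Summable (fun j : ℕ => covTerm α Γ Θ r l s t (n - j + 1)) ∧
      HasCovariation α P (fun ω => X s ω r) (fun ω => X t ω l)
        (∑' j : ℕ, covTerm α Γ Θ r l s t (n - j + 1)) := by
  have := (hPAR.noise_stable 0).finite
  obtain ⟨C, hC, hcov⟩ := hasCovariation_of_hasSum_inner hα hPAR.noise_measurable
    hPAR.noise_indep hPAR.noise_stable (hX.hasSum_inner s r) (hX.hasSum_inner t l)
    (hX.summable_norm_coeffRow s r) (hX.summable_norm_coeffRow t l)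
  rw [← (sub_natCast_injective n).hasSum_iff fun u hu => ?_] at hC
  · have hC' : HasSum (fun j : ℕ => covTerm α Γ Θ r l s t (n - j + 1)) C := by
      convert! hC using 2 with j
      simp only [Function.comp_apply, covTerm]
      refine integral_congr_ae (.of_forall fun x => ?_)
      simp only
      rw [inner_coeffRow Θ r (by omega), inner_coeffRow Θ l (by omega), mul_comm]
    rw [hC'.tsum_eq]
    exact ⟨hC'.summable, hcov⟩
  · have hu := lt_of_notMem_range_sub_natCast hu
    -- For `u > min(s,t)` the row belonging to the earlier time vanishes: the linear factor if `s ≤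
    -- t`, the base of the signed power if `t ≤ s`.
    rcases le_total s t with h | h
    · simp [coeffRow_of_lt Θ r (by omega : s < u)]
    · simp [coeffRow_of_lt Θ l (by omega : t < u), signedPow_zero]

end PAR

end StablePAR

theorem lemma1 {Ω : Type*} [MeasurableSpace Ω] (P : Measure Ω) [IsProbabilityMeasure P]
    {m : ℕ} (α : ℝ) (hα₁ : 1 < α) (hα₂ : α < 2) (T : ℕ)
    (Γ : Measure (StablePAR.UnitSphere m)) (Θ : ℤ → Matrix (Fin m) (Fin m) ℝ)
    (Z X : ℤ → Ω → EuclideanSpace ℝ (Fin m))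
    (hPAR : StablePAR.IsStablePAR1 α T P Γ Θ Z X)
    (hX : StablePAR.IsBoundedSolution P Θ Z X)
    (s t : ℤ) (r l : Fin m) (hrl : r ≠ l) :
    (t ≤ s →
      Summable (fun j : ℕ => StablePAR.covTerm α Γ Θ r l s t (t - j + 1)) ∧
      StablePAR.HasCovariation α P (fun ω => X s ω r) (fun ω => X t ω l)
        (∑' j : ℕ, StablePAR.covTerm α Γ Θ r l s t (t - j + 1))) ∧
    (s ≤ t →
      Summable (fun j : ℕ => StablePAR.covTerm α Γ Θ r l s t (s - j + 1)) ∧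
      StablePAR.HasCovariation α P (fun ω => X s ω r) (fun ω => X t ω l)
        (∑' j : ℕ, StablePAR.covTerm α Γ Θ r l s t (s - j + 1))) := by
  exact ⟨fun h => StablePAR.hasCovariation_components hα₁ hPAR hX s t r l (min_eq_right h).symm,
    fun h => StablePAR.hasCovariation_components hα₁ hPAR hX s t r l (min_eq_left h).symm⟩
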